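/- Let $a,b,x_0\in\mathbb R$ with $|a|\le 1$ and $b\neq 0$, let $0<C<U_{\max}$ and $D:=U_{\max}-C$, and let $\hat a_{\rm init}\in\mathbb R$, $\hat b_{\rm init}\in\mathbb R\setminus\{0\}$. On a probability space $(\Omega,\mathcal F,P)$ let $(W_t)_{t\ge 0}$ be i.i.d. $\mathcal N(0,\Sigma_W^2)$ with $\Sigma_W^2>0$, and let $(V_t)_{t\ge0}$ be i.i.d. uniform on $[-C,C]$, the two sequences being independent of each other. Let $\sigma_D(x):=x$ for $|x|\le D$ and $\sigma_D(x):=Dx/|x|$ for $|x|>D$. Consider the closed loop $$X_0=x_0,\qquad U_t=\sigma_D(G_tX_t)+V_t,\qquad X_{t+1}=aX_t+bU_t+W_t\qquad(t\ge 0),$$ where $G_t:=-\hat a_{\rm init}/\hat b_{\rm init}$ for $t\le 1$ and $G_t:=-\hat a_{t-1}/\hat b_{t-1}$ for $t\ge 2$ (with $G_t:=0$ if $\hat b_{t-1}=0$). Here, for $t\ge1$, $\hat\theta_t=(\hat a_t,\hat b_t)$ is the least-squares estimate $$\hat\theta_t=(\mathbf Z_t^\top\mathbf Z_t)^{\dagger}\mathbf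 Z_t^\top\mathbf X_{t+1},\qquad \mathbf Z_t=[Z_1,\dots,Z_t]^\top,\quad Z_s=(X_s,U_s),\quad \mathbf X_{t+1}=[X_2,\dots,X_{t+1}]^\top,$$ and $\dagger$ is the Moore--Penrose inverse. Let $\theta_*=(a,b)$. Suppose there is $m>0$ such that for all $d\in(0,m)$ $$\sum_{k=1}^{\infty}k^2\sum_{i\ge \max(k-1,1)}P\big(\|\hat\theta_i-\theta_*\|_2>d\big)<\infty .$$ Then there is $e>0$ such that $\sup_{t\ge0}\mathbb E[X_t^2]<e$. -/

import Mathlib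

open MeasureTheory ProbabilityTheory
open scoped ENNReal NNReal Matrix

/-- The four Penrose equations: `B` is a Moore-Penrose inverse of the real matrix `A`. -/
structure IsMoorePenrose {m n : Type*} [Fintype m] [Fintype n]
    (A : Matrix m n ℝ) (B : Matrix n m ℝ) : Prop where
  mul_mul_left : A * B * A = A
  mul_mul_right : B * A * B = B
  symm_left : (A * B)ᵀ = A * B
  symm_right : (B * A)ᵀ = B * A

theorem IsMoorePenrose.unique {m n : Type*} [Fintype m] [Fintype n]
    {A : Matrix m n ℝ} {B C : Matrix n m ℝ}
    (hB : IsMoorePenrose A B) (hC : IsMoorePenrose A C) : B = C := by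
  have h1 : A * B = A * C := by
    calc A * B = (A * B)ᵀ := hB.symm_left.symm
      _ = ((A * C) * (A * B))ᵀ := by
          rw [← Matrix.mul_assoc (A * C) A B, hC.mul_mul_left]
      _ = (A * B)ᵀ * (A * C)ᵀ := Matrix.transpose_mul _ _
      _ = (A * B) * (A * C) := by rw [hB.symm_left, hC.symm_left]
      _ = A * C := by rw [← Matrix.mul_assoc (A * B) A C, hB.mul_mul_left]
  have h2 : B * A = C * A := by
    calc B * A = (B * A)ᵀ := hB.symm_right.symm
      _ = ((B * A) * (C * A))ᵀ := by
          rw [Matrix.mul_assoc B A (C * A), ← Matrix.mul_assoc A C A, hC.mul_mul_left]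
      _ = (C * A)ᵀ * (B * A)ᵀ := Matrix.transpose_mul _ _
      _ = (C * A) * (B * A) := by rw [hB.symm_right, hC.symm_right]
      _ = C * A := by rw [Matrix.mul_assoc C A (B * A), ← Matrix.mul_assoc A B A, hB.mul_mul_left]
  calc B = B * A * B := hB.mul_mul_right.symm
    _ = C * A * C := by rw [h2, Matrix.mul_assoc, h1, ← Matrix.mul_assoc]
    _ = C := hC.mul_mul_right

theorem exists_isMoorePenrose_of_isHermitian {n : Type*} [Fintype n] [DecidableEq n]
    {S : Matrix n n ℝ} (hS : S.IsHermitian) : ∃ B, IsMoorePenrose S B := by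
  set Q : Matrix n n ℝ := (hS.eigenvectorUnitary : Matrix n n ℝ) with hQ
  have hQQ : Qᵀ * Q = 1 := by
    have := Unitary.coe_star_mul_self hS.eigenvectorUnitary
    simpa [Matrix.star_eq_conjTranspose] using this
  have hSd : S = Q * Matrix.diagonal hS.eigenvalues * Qᵀ := by
    have := hS.spectral_theorem
    rw [Unitary.conjStarAlgAut_apply] at this
    simpa [Matrix.star_eq_conjTranspose, Function.comp_def] using this
  have key : ∀ x y : n → ℝ, (Q * Matrix.diagonal x * Qᵀ) * (Q * Matrix.diagonal y * Qᵀ)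
      = Q * Matrix.diagonal (fun i => x i * y i) * Qᵀ := by
    intro x y
    calc (Q * Matrix.diagonal x * Qᵀ) * (Q * Matrix.diagonal y * Qᵀ)
        = Q * Matrix.diagonal x * (Qᵀ * Q) * Matrix.diagonal y * Qᵀ := by
          simp only [Matrix.mul_assoc]
      _ = _ := by rw [hQQ, Matrix.mul_one, Matrix.mul_assoc Q, Matrix.diagonal_mul_diagonal]
  have hT : ∀ x : n → ℝ, (Q * Matrix.diagonal x * Qᵀ)ᵀ = Q * Matrix.diagonal x * Qᵀ := by
    intro x
    simp [Matrix.transpose_mul, Matrix.mul_assoc]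
  refine ⟨Q * Matrix.diagonal (fun i => (hS.eigenvalues i)⁻¹) * Qᵀ, ?_⟩
  obtain ⟨e, he⟩ : ∃ e, e = hS.eigenvalues := ⟨_, rfl⟩
  rw [← he] at hSd ⊢
  clear_value Q
  clear he hQ
  subst hSd
  refine ⟨?_, ?_, ?_, ?_⟩
  · simp [key]
  · rw [key, key]
    congr 3
    funext i
    by_cases h : e i = 0 <;> simp [h]
  · rw [key, hT]
  · rw [key, hT]

theorem exists_isMoorePenrose {m n : Type*} [Fintype m] [Fintype n]
    (A : Matrix m n ℝ) : ∃ B, IsMoorePenrose A B := by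
  classical
  obtain ⟨P, hP⟩ := exists_isMoorePenrose_of_isHermitian
    (Matrix.isHermitian_conjTranspose_mul_self A)
  rw [Matrix.conjTranspose_eq_transpose_of_trivial] at hP
  have hS : (Aᵀ * A)ᵀ = Aᵀ * A := by simp
  have hPt : Pᵀ = P := by
    refine IsMoorePenrose.unique (A := Aᵀ * A) ⟨?_, ?_, ?_, ?_⟩ hP
    · have := congrArg Matrix.transpose hP.mul_mul_left
      simpa only [Matrix.transpose_mul, Matrix.transpose_transpose, Matrix.mul_assoc] using this
    · have := congrArg Matrix.transpose hP.mul_mul_right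
      simpa only [Matrix.transpose_mul, Matrix.transpose_transpose, Matrix.mul_assoc] using this
    · have := hP.symm_right
      rw [Matrix.transpose_mul, hS] at this
      rw [this, hP.symm_right]
    · have := hP.symm_left
      rw [Matrix.transpose_mul, hS] at this
      rw [this, hP.symm_left]
  refine ⟨P * Aᵀ, ?_, ?_, ?_, ?_⟩
  · have h0 : Aᴴ * A * (P * (Aᵀ * A) - 1) = 0 := by
      rw [Matrix.conjTranspose_eq_transpose_of_trivial, Matrix.mul_sub, ← Matrix.mul_assoc,
        hP.mul_mul_left, Matrix.mul_one, sub_self]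
    rw [Matrix.conjTranspose_mul_self_mul_eq_zero, Matrix.mul_sub, Matrix.mul_one,
      sub_eq_zero] at h0
    simpa only [Matrix.mul_assoc] using h0
  · have := congrArg (· * Aᵀ) hP.mul_mul_right
    simpa only [Matrix.mul_assoc] using this
  · simp [Matrix.transpose_mul, hPt, Matrix.mul_assoc]
  · have := hP.symm_right
    simpa only [Matrix.mul_assoc] using this

/-- The Moore-Penrose inverse of a real matrix. -/
noncomputable def pinv {m n : Type*} [Fintype m] [Fintype n]
    (A : Matrix m n ℝ) : Matrix n m ℝ :=
  (exists_isMoorePenrose A).choose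

theorem pinv_spec {m n : Type*} [Fintype m] [Fintype n]
    (A : Matrix m n ℝ) : IsMoorePenrose A (pinv A) :=
  (exists_isMoorePenrose A).choose_spec

/-- The saturation function with level `r`. -/
noncomputable def sat (r x : ℝ) : ℝ := if |x| ≤ r then x else r * x / |x|

/-- The data matrix with the `t` rows `(x s, u s)`, `s = 1, …, t`. -/
def dataMatrix (x u : ℕ → ℝ) (t : ℕ) : Matrix (Fin t) (Fin 2) ℝ :=
  Matrix.of fun s => ![x (s + 1), u (s + 1)]

/-- The response vector `(x 2, …, x (t + 1))`. -/
def responseVector (x : ℕ → ℝ) (t : ℕ) : Fin t → ℝ := fun s => x (s + 2)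

/-- The least-squares estimate `(ZᵀZ)† Zᵀ y` of the parameters at time `t`, for the state path `x`
and the input path `u`; meant for `t ≥ 1`. It depends on `x 1, …, x (t + 1)` and
`u 1, …, u t` only. -/
noncomputable def estimate (x u : ℕ → ℝ) (t : ℕ) : EuclideanSpace ℝ (Fin 2) :=
  WithLp.toLp 2 ((pinv ((dataMatrix x u t)ᵀ * dataMatrix x u t) * (dataMatrix x u t)ᵀ) *ᵥ
    responseVector x t)

/-- The certainty-equivalent gain factor at time `t`, with initial estimate `(aInit, bInit)`. -/
noncomputable def gain (aInit bInit : ℝ) (x u : ℕ → ℝ) (t : ℕ) : ℝ :=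
  if t ≤ 1 then -aInit / bInit else -(estimate x u (t - 1) 0) / estimate x u (t - 1) 1

/-- `x` and `u` are the state and input paths of the closed loop, started at `x₀`, with plant
parameters `a, b`, disturbance path `w` and excitation path `v`, under the adaptive policy with
saturation level `D` and initial estimate `(aInit, bInit)`. These equations determine
`x` and `u` recursively. -/
structure IsClosedLoop (a b x₀ D aInit bInit : ℝ) (w v x u : ℕ → ℝ) : Prop where
  init : x 0 = x₀
  control : ∀ t, u t = sat D (gain aInit bInit x u t * x t) + v t
  step : ∀ t, x (t + 1) = a * x t + b * u t + w t

/-! Write `X (t + 1) = H t + ξ t`, where `ξ t = b V t + W t` is subgaussian and independent of the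
past, and put `β = |b| D`. Call a time good if `|H t| ≤ max (|X t| - β) K`. At good times the inward
drift beats the noise in an exponential moment of small exponent. Bad times are charged to a running
envelope, frozen at good times and raised to cover the state after bad ones. The excess over the
envelope then has bounded exponential moments (`exists_lintegral_eexp_excess_le`).

The second moment of the envelope is at most a constant plus the sum of `E[X (k + 1) ^ 2; k bad]`.
Since `|H t| ≤ |X t| + β` always, `|X k|` is of order `k` up to exponentially small tails, so this
sum is finite once `∑ (k + 1) ^ 2 P(k bad) < ∞` (`iSup_lintegral_sq_lt_top`).

If `|a| < 1`, every time is good for large `K`. If `|a| = 1`, a gain close to `-a / b` makes the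
saturated control push with full force `β` against the state, so a bad time `t ≥ 2` forces an
estimation error above a fixed `d`; the tail hypothesis makes these probabilities summable with the
required weight. -/

section Stability

/-! ### Exponential moments under independent noise. -/

variable {Ω : Type*}

/-- The real exponential, with values in `ℝ≥0∞`. -/
noncomputable def eexp (x : ℝ) : ℝ≥0∞ := ENNReal.ofReal (Real.exp x)

theorem eexp_add (x y : ℝ) : eexp (x + y) = eexp x * eexp y := by
  simp [eexp, Real.exp_add, ENNReal.ofReal_mul (Real.exp_nonneg x)]

theorem eexp_mono {x y : ℝ} (h : x ≤ y) : eexp x ≤ eexp y :=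
  ENNReal.ofReal_le_ofReal (Real.exp_le_exp.2 h)

theorem eexp_zero : eexp 0 = 1 := by simp [eexp]

theorem eexp_le_one {x : ℝ} (h : x ≤ 0) : eexp x ≤ 1 := eexp_zero ▸ eexp_mono h

theorem eexp_ne_top (x : ℝ) : eexp x ≠ ∞ := ENNReal.ofReal_ne_top

theorem measurable_eexp : Measurable eexp :=
  ENNReal.measurable_ofReal.comp Real.measurable_exp

theorem eexp_max_zero_le (x : ℝ) : eexp (max x 0) ≤ 1 + eexp x := by
  rcases le_total x 0 with h | h
  · rw [max_eq_right h, eexp_zero]; exact le_self_add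
  · rw [max_eq_left h]; exact le_add_self

theorem eexp_abs_le (x : ℝ) : eexp |x| ≤ eexp x + eexp (-x) := by
  rcases abs_cases x with ⟨h, _⟩ | ⟨h, _⟩ <;> rw [h]
  · exact le_self_add
  · exact le_add_self

/-- Coefficient 1 on `eexp |x|` matters: the cruder `2 * eexp |x|` would double the contraction
factor of the drift argument. -/
theorem eexp_add_eexp_neg_le (x : ℝ) : eexp x + eexp (-x) ≤ eexp |x| + 1 := by
  rcases abs_cases x with ⟨h, h'⟩ | ⟨h, h'⟩ <;> rw [h]
  · exact add_le_add le_rfl (eexp_le_one (by linarith))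
  · rw [add_comm]; exact add_le_add le_rfl (eexp_le_one (by linarith))

theorem ofReal_sq_le_eexp {x : ℝ} (hx : 0 ≤ x) : ENNReal.ofReal (x ^ 2) ≤ 2 * eexp x := by
  have h := Real.quadratic_le_exp_of_nonneg hx
  rw [eexp, ← ENNReal.ofReal_ofNat 2, ← ENNReal.ofReal_mul (by norm_num)]
  exact ENNReal.ofReal_le_ofReal (by nlinarith)

theorem lintegral_eexp_mul_le [MeasurableSpace Ω] {P : Measure Ω} {ξ : Ω → ℝ} {c : ℝ≥0}
    (h : HasSubgaussianMGF ξ c P) (r : ℝ) :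
    ∫⁻ ω, eexp (r * ξ ω) ∂P ≤ eexp (c * r ^ 2 / 2) := by
  unfold eexp
  rw [← ofReal_integral_eq_lintegral_ofReal (h.integrable_exp_mul r)
    (Filter.Eventually.of_forall fun _ => Real.exp_nonneg _)]
  exact ENNReal.ofReal_le_ofReal (h.mgf_le r)

/-- Subgaussian noise that is independent of the past changes exponential moments by a bounded
factor. -/
theorem lintegral_mul_eexp_abs_add_le {F mΩ : MeasurableSpace Ω} {P : Measure Ω}
    (hF : F ≤ mΩ) {ξ H : Ω → ℝ}
    {c : ℝ≥0} (hξ : Measurable ξ) (hsub : HasSubgaussianMGF ξ c P)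
    (hind : Indep F (MeasurableSpace.comap ξ inferInstance) P)
    (hH : Measurable[F] H) {f : Ω → ℝ≥0∞} (hf : Measurable[F] f) {r : ℝ} (hr : 0 ≤ r) :
    ∫⁻ ω, f ω * eexp (r * |H ω + ξ ω|) ∂P ≤
      eexp (c * r ^ 2 / 2) * ∫⁻ ω, f ω * (eexp (r * H ω) + eexp (-(r * H ω))) ∂P := by
  -- Independence splits off the noise for each sign `s = ±r` separately, since the absolute value
  -- does not factor.
  have key : ∀ s : ℝ, ∫⁻ ω, f ω * eexp (s * H ω) * eexp (s * ξ ω) ∂P ≤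
      eexp (c * s ^ 2 / 2) * ∫⁻ ω, f ω * eexp (s * H ω) ∂P := by
    intro s
    have m1 : Measurable[F] fun ω => f ω * eexp (s * H ω) :=
      hf.mul (measurable_eexp.comp (hH.const_mul s))
    have m2 : Measurable[MeasurableSpace.comap ξ inferInstance] fun ω => eexp (s * ξ ω) :=
      (measurable_eexp.comp (measurable_id.const_mul s)).comp (comap_measurable ξ)
    rw [lintegral_mul_eq_lintegral_mul_lintegral_of_independent_measurableSpace hF
      hξ.comap_le hind m1 m2, mul_comm]
    exact mul_le_mul' (lintegral_eexp_mul_le hsub s) le_rfl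
  have mf : Measurable f := hf.mono hF le_rfl
  have mH : Measurable H := hH.mono hF le_rfl
  have mm : ∀ s : ℝ, Measurable fun ω => f ω * eexp (s * H ω) := fun s =>
    mf.mul (measurable_eexp.comp (mH.const_mul s))
  calc ∫⁻ ω, f ω * eexp (r * |H ω + ξ ω|) ∂P
      ≤ ∫⁻ ω, (f ω * eexp (r * H ω) * eexp (r * ξ ω)
          + f ω * eexp (-r * H ω) * eexp (-r * ξ ω)) ∂P := by
        refine lintegral_mono fun ω => ?_
        dsimp only
        have h1 : r * |H ω + ξ ω| = |r * (H ω + ξ ω)| := by rw [abs_mul, abs_of_nonneg hr]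
        rw [h1, mul_assoc, mul_assoc, ← eexp_add, ← eexp_add, ← mul_add]
        refine mul_le_mul' le_rfl ((eexp_abs_le _).trans (le_of_eq ?_))
        congr 2 <;> ring
    _ = ∫⁻ ω, f ω * eexp (r * H ω) * eexp (r * ξ ω) ∂P
          + ∫⁻ ω, f ω * eexp (-r * H ω) * eexp (-r * ξ ω) ∂P :=
        lintegral_add_left
          (f := fun ω => f ω * eexp (r * H ω) * eexp (r * ξ ω))
          ((mm r).mul (measurable_eexp.comp (hξ.const_mul r))) _
    _ ≤ eexp (c * r ^ 2 / 2) * ∫⁻ ω, f ω * eexp (r * H ω) ∂P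
          + eexp (c * (-r) ^ 2 / 2) * ∫⁻ ω, f ω * eexp (-r * H ω) ∂P :=
        add_le_add (key r) (key (-r))
    _ = _ := by
        simp only [mul_add, neg_mul, neg_sq]
        rw [← mul_add, ← lintegral_add_left (mm r)]

/-! ### The envelope and the abstract stability theorem. -/

/-- The running envelope of a process: it follows the process at the times outside `G` and is
frozen at the times in `G`. -/
noncomputable def envelope (X : ℕ → Ω → ℝ) (G : ℕ → Set Ω) (K : ℝ) : ℕ → Ω → ℝ
  | 0, ω => max K |X 0 ω|
  | t + 1, ω => max (envelope X G K t ω) ((G t)ᶜ.indicator (fun ω => |X (t + 1) ω|) ω)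

theorem le_envelope (X : ℕ → Ω → ℝ) (G : ℕ → Set Ω) (K : ℝ) (t : ℕ) (ω : Ω) :
    K ≤ envelope X G K t ω := by
  induction t with
  | zero => exact le_max_left _ _
  | succ t ih => exact ih.trans (le_max_left _ _)

theorem envelope_succ_of_mem {X : ℕ → Ω → ℝ} {G : ℕ → Set Ω} {K : ℝ} (hK : 0 ≤ K) {t : ℕ} {ω : Ω}
    (h : ω ∈ G t) : envelope X G K (t + 1) ω = envelope X G K t ω := by
  rw [envelope, Set.indicator_of_notMem (by simpa using h),
    max_eq_left (hK.trans (le_envelope X G K t ω))]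

theorem abs_le_envelope_succ_of_notMem {X : ℕ → Ω → ℝ} {G : ℕ → Set Ω} {K : ℝ} {t : ℕ} {ω : Ω}
    (h : ω ∉ G t) : |X (t + 1) ω| ≤ envelope X G K (t + 1) ω := by
  rw [envelope, Set.indicator_of_mem (by simpa using h)]
  exact le_max_right _ _

theorem measurable_envelope {F : ℕ → MeasurableSpace Ω} (hmono : Monotone F) {X : ℕ → Ω → ℝ}
    (hX : ∀ t, Measurable[F t] (X t)) {G : ℕ → Set Ω} (hG : ∀ t, MeasurableSet[F t] (G t)) (K : ℝ)
    (t : ℕ) : Measurable[F t] (envelope X G K t) := by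
  induction t with
  | zero =>
    let := F 0
    exact measurable_const.max (measurable_norm.comp (hX 0))
  | succ t ih =>
    let := F (t + 1)
    have h1 : Measurable[F (t + 1)] (envelope X G K t) := ih.mono (hmono t.le_succ) le_rfl
    have h2 : MeasurableSet[F (t + 1)] (G t)ᶜ := ((hmono t.le_succ) _ (hG t)).compl
    exact h1.max ((measurable_norm.comp (hX (t + 1))).indicator h2)

/-- The square of a maximum of nonnegative numbers is at most the sum of the squares, and the
envelope moves only at bad times. -/
theorem lintegral_envelope_sq_le [MeasurableSpace Ω] {P : Measure Ω} {X : ℕ → Ω → ℝ}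
    (hX : ∀ t, Measurable (X t)) {G : ℕ → Set Ω} (hG : ∀ t, MeasurableSet (G t)) {K : ℝ} (hK : 0 ≤ K) (t : ℕ) :
    ∫⁻ ω, ENNReal.ofReal (envelope X G K t ω ^ 2) ∂P ≤
      ∫⁻ ω, ENNReal.ofReal (max K |X 0 ω| ^ 2) ∂P +
        ∑' k, ∫⁻ ω in (G k)ᶜ, ENNReal.ofReal (X (k + 1) ω ^ 2) ∂P := by
  suffices h : ∫⁻ ω, ENNReal.ofReal (envelope X G K t ω ^ 2) ∂P ≤
      ∫⁻ ω, ENNReal.ofReal (max K |X 0 ω| ^ 2) ∂P +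
        ∑ k ∈ Finset.range t, ∫⁻ ω in (G k)ᶜ, ENNReal.ofReal (X (k + 1) ω ^ 2) ∂P from
    h.trans (add_le_add le_rfl (ENNReal.sum_le_tsum _))
  induction t with
  | zero => simp [envelope]
  | succ t ih =>
    rw [Finset.sum_range_succ, ← add_assoc]
    refine le_trans ?_ (add_le_add ih le_rfl)
    rw [← lintegral_indicator (hG t).compl, ← lintegral_add_right _
      (((hX (t + 1)).pow_const 2).ennreal_ofReal.indicator (hG t).compl)]
    refine lintegral_mono fun ω => ?_
    by_cases h : ω ∈ G t
    · simp [envelope_succ_of_mem hK h]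
    · have h0 := hK.trans (le_envelope X G K t ω)
      rw [Set.indicator_of_mem (by simpa using h), envelope, Set.indicator_of_mem (by simpa using h)]
      rcases max_cases (envelope X G K t ω) |X (t + 1) ω| with ⟨h, _⟩ | ⟨h, _⟩ <;> rw [h]
      · exact le_self_add
      · rw [sq_abs]; exact le_add_self

theorem exists_const_of_geometric_drift {u : ℕ → ℝ≥0∞} {ρ B : ℝ≥0∞} (hρ : ρ < 1) (hB : B ≠ ∞)
    (h0 : u 0 ≠ ∞) (h : ∀ t, u (t + 1) ≤ B + ρ * u t) : ∃ R : ℝ≥0∞, R ≠ ∞ ∧ ∀ t, u t ≤ R := by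
  have h1 : 1 - ρ ≠ 0 := (tsub_pos_of_lt hρ).ne'
  have h1' : 1 - ρ ≠ ∞ := ne_top_of_le_ne_top ENNReal.one_ne_top tsub_le_self
  -- `B / (1 - ρ)` is the fixed point of `x ↦ B + ρ * x`.
  refine ⟨u 0 + B / (1 - ρ), ENNReal.add_ne_top.2 ⟨h0, ENNReal.div_ne_top hB h1⟩, fun t => ?_⟩
  induction t with
  | zero => exact le_self_add
  | succ t ih =>
    calc u (t + 1) ≤ B + ρ * (u 0 + B / (1 - ρ)) :=
          (h t).trans (add_le_add le_rfl (mul_le_mul' le_rfl ih))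
      _ = ρ * u 0 + ((1 - ρ) * (B / (1 - ρ)) + ρ * (B / (1 - ρ))) := by
          rw [ENNReal.mul_div_cancel h1 h1']; ring
      _ = ρ * u 0 + B / (1 - ρ) := by
          rw [← add_mul, tsub_add_cancel_of_le hρ.le, one_mul]
      _ ≤ _ := add_le_add (mul_le_of_le_one_left' hρ.le) le_rfl

/-- A process `X (t + 1) = H t + ξ t` driven by independent subgaussian noise, whose drift term
satisfies the contraction estimate on the events `G t`, has bounded exponential excess over its
envelope. -/
theorem exists_lintegral_eexp_excess_le [mΩ : MeasurableSpace Ω] {P : Measure Ω}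
    [IsProbabilityMeasure P] {F : ℕ → MeasurableSpace Ω}
    (hF : ∀ t, F t ≤ mΩ)
    (hmono : Monotone F) {X H ξ : ℕ → Ω → ℝ} {G : ℕ → Set Ω} {c : ℝ≥0} {β K r : ℝ}
    (hX : ∀ t, Measurable[F t] (X t)) (hH : ∀ t, Measurable[F t] (H t))
    (hG : ∀ t, MeasurableSet[F t] (G t)) (hξ : ∀ t, Measurable (ξ t))
    (hsub : ∀ t, HasSubgaussianMGF (ξ t) c P)
    (hind : ∀ t, Indep (F t) (MeasurableSpace.comap (ξ t) inferInstance) P)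
    (hstep : ∀ t ω, X (t + 1) ω = H t ω + ξ t ω) (hK : 0 ≤ K)
    (hdrift : ∀ t, ∀ ω ∈ G t, |H t ω| ≤ max (|X t ω| - β) K)
    (hr : 0 ≤ r) (hcr : c * r ^ 2 / 2 - r * β < 0) :
    ∃ R : ℝ≥0∞, R ≠ ∞ ∧ ∀ t,
      ∫⁻ ω, eexp (r * max (|X t ω| - envelope X G K t ω) 0) ∂P ≤ R := by
  set L := envelope X G K with hL
  have mL : ∀ t, Measurable[F t] (L t) := measurable_envelope hmono hX hG K
  set M : ℝ≥0∞ := eexp (c * r ^ 2 / 2) with hM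
  have hM' : M ≠ ∞ := eexp_ne_top _
  have hbase : ∫⁻ ω, eexp (r * max (|X 0 ω| - L 0 ω) 0) ∂P = 1 := by
    have : ∀ ω, eexp (r * max (|X 0 ω| - L 0 ω) 0) = 1 := fun ω => by
      rw [max_eq_right, mul_zero, eexp_zero]
      simp [hL, envelope]
    simp [this]
  -- `ρ` is the noise factor `M` times the drift gain `eexp (-(r * β))`. In `B`, the 1 covers bad
  -- times and the positive part; the 2 covers the case `|H| ≤ K` and the second exponential.
  refine exists_const_of_geometric_drift (ρ := eexp (c * r ^ 2 / 2 - r * β)) (B := 1 + M * 2)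
    ?_ ?_ ?_ fun t => ?_
  · rw [eexp, ENNReal.ofReal_lt_one]
    rwa [← Real.exp_zero, Real.exp_lt_exp]
  · exact ENNReal.add_ne_top.2 ⟨ENNReal.one_ne_top, ENNReal.mul_ne_top hM' ENNReal.ofNat_ne_top⟩
  · rw [hbase]; exact ENNReal.one_ne_top
  -- On `G t` the envelope at time `t + 1` is still `L t`, known at time `t`; hence this weight is
  -- independent of `ξ t`.
  have mf : Measurable[F t] ((G t).indicator fun ω => eexp (-(r * L t ω))) := by
    let := F t
    exact (measurable_eexp.comp ((mL t).const_mul r).neg).indicator (hG t)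
  have mΦ : Measurable fun ω => eexp (r * max (|X t ω| - L t ω) 0) := by
    refine Measurable.mono (ma := F t) ?_ (hF t) le_rfl
    let := F t
    exact measurable_eexp.comp
      ((((measurable_norm.comp (hX t)).sub (mL t)).max measurable_const).const_mul r)
  calc ∫⁻ ω, eexp (r * max (|X (t + 1) ω| - L (t + 1) ω) 0) ∂P
      ≤ ∫⁻ ω, (1 + (G t).indicator (fun ω => eexp (-(r * L t ω))) ω
          * eexp (r * |H t ω + ξ t ω|)) ∂P := by
        refine lintegral_mono fun ω => ?_
        by_cases h : ω ∈ G t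
        · rw [Set.indicator_of_mem h, ← eexp_add, ← hstep, hL, envelope_succ_of_mem hK h]
          have : r * max (|X (t + 1) ω| - envelope X G K t ω) 0
              = max (-(r * envelope X G K t ω) + r * |X (t + 1) ω|) 0 := by
            rw [mul_max_of_nonneg _ _ hr, mul_zero]; congr 1; ring
          dsimp only
          rw [this]
          exact eexp_max_zero_le _
        · have h' : |X (t + 1) ω| - L (t + 1) ω ≤ 0 :=
            sub_nonpos.2 (abs_le_envelope_succ_of_notMem h)
          dsimp only
          rw [max_eq_right h', mul_zero, eexp_zero]
          exact le_self_add
    _ = 1 + ∫⁻ ω, (G t).indicator (fun ω => eexp (-(r * L t ω))) ω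
          * eexp (r * |H t ω + ξ t ω|) ∂P := by
        rw [lintegral_add_left measurable_const]; simp
    _ ≤ 1 + M * ∫⁻ ω, (G t).indicator (fun ω => eexp (-(r * L t ω))) ω
          * (eexp (r * H t ω) + eexp (-(r * H t ω))) ∂P :=
        add_le_add le_rfl (lintegral_mul_eexp_abs_add_le (hF t) (hξ t) (hsub t) (hind t) (hH t)
          mf hr)
    _ ≤ 1 + M * ∫⁻ ω, (2 + eexp (-(r * β)) * eexp (r * max (|X t ω| - L t ω) 0)) ∂P := by
        refine add_le_add le_rfl (mul_le_mul' le_rfl (lintegral_mono fun ω => ?_))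
        by_cases h : ω ∈ G t
        · have hLK : K ≤ L t ω := le_envelope X G K t ω
          have hd := hdrift t ω h
          dsimp only
          rw [Set.indicator_of_mem h]
          refine (mul_le_mul' le_rfl (eexp_add_eexp_neg_le _)).trans ?_
          rw [mul_add, mul_one, ← eexp_add, abs_mul, abs_of_nonneg hr, ← eexp_add]
          have e1 : eexp (-(r * L t ω)) ≤ 1 :=
            eexp_le_one (neg_nonpos.2 (mul_nonneg hr (hK.trans hLK)))
          have e2 : eexp (-(r * L t ω) + r * |H t ω|)
              ≤ 1 + eexp (-(r * β) + r * max (|X t ω| - L t ω) 0) := by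
            rcases le_max_iff.1 hd with h1 | h1
            · refine (eexp_mono ?_).trans le_add_self
              have : r * |H t ω| ≤ r * (max (|X t ω| - L t ω) 0 + L t ω - β) := by
                refine mul_le_mul_of_nonneg_left ?_ hr
                linarith [le_max_left (|X t ω| - L t ω) 0]
              linarith
            · refine (eexp_le_one ?_).trans le_self_add
              have : r * |H t ω| ≤ r * L t ω := mul_le_mul_of_nonneg_left (h1.trans hLK) hr
              linarith
          refine (add_le_add e2 e1).trans (le_of_eq ?_)
          rw [add_right_comm, one_add_one_eq_two]
        · rw [Set.indicator_of_notMem h, zero_mul]; exact zero_le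
    _ = _ := by
        rw [lintegral_add_left measurable_const, lintegral_const_mul _ mΦ, lintegral_const,
          measure_univ, mul_one, mul_add, ← add_assoc, ← mul_assoc, hM, ← eexp_add,
          ← sub_eq_add_neg]

/-- A crude bound valid at good and bad times alike: each step costs a constant factor, the 2 from
the two signs being absorbed in `eexp 1`. -/
theorem lintegral_eexp_abs_le_of_linear_growth [mΩ : MeasurableSpace Ω] {P : Measure Ω}
    [IsProbabilityMeasure P] {F : ℕ → MeasurableSpace Ω}
    (hF : ∀ t, F t ≤ mΩ) {X H ξ : ℕ → Ω → ℝ} {c : ℝ≥0} {β x₀ r : ℝ}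
    (hH : ∀ t, Measurable[F t] (H t)) (hξ : ∀ t, Measurable (ξ t))
    (hsub : ∀ t, HasSubgaussianMGF (ξ t) c P)
    (hind : ∀ t, Indep (F t) (MeasurableSpace.comap (ξ t) inferInstance) P)
    (h0 : ∀ ω, X 0 ω = x₀) (hstep : ∀ t ω, X (t + 1) ω = H t ω + ξ t ω)
    (hgrow : ∀ t ω, |H t ω| ≤ |X t ω| + β) (hr : 0 ≤ r) (t : ℕ) :
    ∫⁻ ω, eexp (r * |X t ω|) ∂P ≤ eexp (r * |x₀| + (c * r ^ 2 / 2 + r * β + 1) * t) := by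
  induction t with
  | zero => simp [h0]
  | succ t ih =>
    have h2 : (2 : ℝ≥0∞) ≤ eexp 1 := by
      rw [eexp, ← ENNReal.ofReal_ofNat 2]
      exact ENNReal.ofReal_le_ofReal (by linarith [Real.add_one_le_exp 1])
    have h := lintegral_mul_eexp_abs_add_le (hF t) (hξ t) (hsub t) (hind t) (hH t)
      (f := fun _ => 1) measurable_const hr
    simp only [one_mul, ← hstep] at h
    calc ∫⁻ ω, eexp (r * |X (t + 1) ω|) ∂P
        ≤ eexp (c * r ^ 2 / 2) * ∫⁻ ω, eexp (r * H t ω) + eexp (-(r * H t ω)) ∂P := h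
      _ ≤ eexp (c * r ^ 2 / 2) * ∫⁻ ω, eexp (1 + r * β) * eexp (r * |X t ω|) ∂P := by
          refine mul_le_mul' le_rfl (lintegral_mono fun ω => ?_)
          have h1 : |r * H t ω| ≤ r * β + r * |X t ω| := by
            rw [abs_mul, abs_of_nonneg hr, ← mul_add]
            exact mul_le_mul_of_nonneg_left ((hgrow t ω).trans_eq (add_comm _ _)) hr
          calc eexp (r * H t ω) + eexp (-(r * H t ω))
              ≤ eexp |r * H t ω| + eexp |r * H t ω| :=
                add_le_add (eexp_mono (le_abs_self _)) (eexp_mono (neg_le_abs _))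
            _ ≤ eexp 1 * eexp (r * β + r * |X t ω|) := by
                rw [← two_mul]; exact mul_le_mul' h2 (eexp_mono h1)
            _ = _ := by simp only [eexp_add, mul_assoc]
      _ = eexp (c * r ^ 2 / 2 + (1 + r * β)) * ∫⁻ ω, eexp (r * |X t ω|) ∂P := by
          rw [lintegral_const_mul' _ _ (eexp_ne_top _), ← mul_assoc, ← eexp_add]
      _ ≤ eexp (c * r ^ 2 / 2 + (1 + r * β)) *
            eexp (r * |x₀| + (c * r ^ 2 / 2 + r * β + 1) * t) := mul_le_mul' le_rfl ih
      _ = _ := by rw [← eexp_add]; congr 1; push_cast; ring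

/-- Split at `|Y| = A`; above it, `Y ^ 2 ≤ 2 e^|Y| ≤ 2 e^(-A) e^(2|Y|)`. -/
theorem setLIntegral_sq_le [MeasurableSpace Ω] {P : Measure Ω} {Y : Ω → ℝ} {A : ℝ}
    (S : Set Ω) (hS : MeasurableSet S) :
    ∫⁻ ω in S, ENNReal.ofReal (Y ω ^ 2) ∂P ≤
      ENNReal.ofReal (A ^ 2) * P S + 2 * eexp (-A) * ∫⁻ ω, eexp (2 * |Y ω|) ∂P := by
  have hpt : ∀ ω, S.indicator (fun ω => ENNReal.ofReal (Y ω ^ 2)) ω ≤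
      S.indicator (fun _ => ENNReal.ofReal (A ^ 2)) ω + 2 * eexp (-A) * eexp (2 * |Y ω|) := by
    intro ω
    by_cases h : ω ∈ S
    · rw [Set.indicator_of_mem h, Set.indicator_of_mem h]
      rcases le_total |Y ω| A with h1 | h1
      · exact (ENNReal.ofReal_le_ofReal (sq_le_sq' (abs_le.1 h1).1 (abs_le.1 h1).2)).trans
          le_self_add
      · refine le_trans ?_ le_add_self
        rw [← sq_abs, mul_assoc, ← eexp_add]
        refine (ofReal_sq_le_eexp (abs_nonneg _)).trans (mul_le_mul' le_rfl (eexp_mono ?_))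
        linarith
    · rw [Set.indicator_of_notMem h]; exact zero_le
  calc ∫⁻ ω in S, ENNReal.ofReal (Y ω ^ 2) ∂P
      = ∫⁻ ω, S.indicator (fun ω => ENNReal.ofReal (Y ω ^ 2)) ω ∂P := (lintegral_indicator hS _).symm
    _ ≤ _ := lintegral_mono hpt
    _ = _ := by
        rw [lintegral_add_left (measurable_const.indicator hS), lintegral_indicator_const hS,
          lintegral_const_mul' _ _
            (ENNReal.mul_ne_top ENNReal.ofNat_ne_top (eexp_ne_top _))]

theorem tsum_eexp_neg_ne_top : ∑' k : ℕ, eexp (-(k : ℝ)) ≠ ∞ := by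
  unfold eexp
  rw [← ENNReal.ofReal_tsum_of_nonneg (fun _ => Real.exp_nonneg _) Real.summable_exp_neg_nat]
  exact ENNReal.ofReal_ne_top

/-- Mean-square stability: if the drift estimate fails at time `t` with a probability `p t` such
that `∑ (t + 1) ^ 2 * p t < ∞`, then the second moments are bounded. -/
theorem iSup_lintegral_sq_lt_top [mΩ : MeasurableSpace Ω] {P : Measure Ω}
    [IsProbabilityMeasure P] {F : ℕ → MeasurableSpace Ω}
    (hF : ∀ t, F t ≤ mΩ) (hmono : Monotone F) {X H ξ : ℕ → Ω → ℝ} {G : ℕ → Set Ω} {c : ℝ≥0}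
    {β K x₀ : ℝ} (hX : ∀ t, Measurable[F t] (X t)) (hH : ∀ t, Measurable[F t] (H t))
    (hG : ∀ t, MeasurableSet[F t] (G t)) (hξ : ∀ t, Measurable (ξ t))
    (hsub : ∀ t, HasSubgaussianMGF (ξ t) c P)
    (hind : ∀ t, Indep (F t) (MeasurableSpace.comap (ξ t) inferInstance) P)
    (h0 : ∀ ω, X 0 ω = x₀) (hstep : ∀ t ω, X (t + 1) ω = H t ω + ξ t ω)
    (hgrow : ∀ t ω, |H t ω| ≤ |X t ω| + β) (hβ : 0 < β) (hK : 0 ≤ K)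
    (hdrift : ∀ t, ∀ ω ∈ G t, |H t ω| ≤ max (|X t ω| - β) K)
    (hbad : ∑' t : ℕ, ((t : ℝ≥0∞) + 1) ^ 2 * P (G t)ᶜ ≠ ∞) :
    (⨆ t, ∫⁻ ω, ENNReal.ofReal (X t ω ^ 2) ∂P) < ∞ := by
  have mX : ∀ t, Measurable (X t) := fun t => (hX t).mono (hF t) le_rfl
  have mG : ∀ t, MeasurableSet (G t) := fun t => hF t _ (hG t)
  -- Then `r * β = (c + 1) * r ^ 2`, which exceeds the noise cost `c * r ^ 2 / 2`.
  set r : ℝ := β / (c + 1) with hrdef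
  have hc : (0 : ℝ) ≤ c := c.2
  have hr : 0 < r := by positivity
  have hcr : c * r ^ 2 / 2 - r * β < 0 := by
    have : r * (c + 1) = β := by rw [hrdef]; field_simp
    rw [← this]
    nlinarith [mul_nonneg hc (sq_nonneg r), sq_pos_of_pos hr]
  obtain ⟨R, hR, hRb⟩ := exists_lintegral_eexp_excess_le hF hmono hX hH hG hξ hsub hind hstep hK
    hdrift hr.le hcr
  set q : ℝ := c * 2 ^ 2 / 2 + 2 * β + 1 with hq
  have hq0 : 0 ≤ q := by positivity
  set S : ℝ≥0∞ := ∫⁻ ω, ENNReal.ofReal (max K |X 0 ω| ^ 2) ∂P +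
    ∑' k, ∫⁻ ω in (G k)ᶜ, ENNReal.ofReal (X (k + 1) ω ^ 2) ∂P with hS
  have hS' : S ≠ ∞ := by
    refine ENNReal.add_ne_top.2 ⟨by simp [h0], ?_⟩
    have hk : ∀ k : ℕ, ∫⁻ ω in (G k)ᶜ, ENNReal.ofReal (X (k + 1) ω ^ 2) ∂P ≤
        ENNReal.ofReal ((q + 1) ^ 2) * (((k : ℝ≥0∞) + 1) ^ 2 * P (G k)ᶜ)
          + 2 * eexp (2 * |x₀|) * eexp (-(k : ℝ)) := by
      intro k
      -- `q` is the growth rate per step at exponent 2, so this level leaves a summable `e^(-(k +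
      -- 1))`; its square is the source of the weight `(k + 1) ^ 2`.
      refine (setLIntegral_sq_le (A := (q + 1) * (k + 1)) _ (mG k).compl).trans ?_
      have h1 := lintegral_eexp_abs_le_of_linear_growth hF hH hξ hsub hind h0 hstep hgrow
        (r := 2) zero_le_two (k + 1)
      refine add_le_add (le_of_eq ?_) ?_
      · rw [mul_pow, ENNReal.ofReal_mul (by positivity), ENNReal.ofReal_pow (by positivity) 2,
          ENNReal.ofReal_pow (by positivity) 2, ENNReal.ofReal_add (p := (k : ℝ)) (by positivity) zero_le_one,
          ENNReal.ofReal_natCast, ENNReal.ofReal_one, mul_assoc]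
      · refine (mul_le_mul' le_rfl h1).trans ?_
        rw [mul_assoc, mul_assoc, ← eexp_add, ← eexp_add]
        refine mul_le_mul' le_rfl (eexp_mono ?_)
        rw [← hq]; push_cast; linarith
    refine ne_top_of_le_ne_top ?_ (ENNReal.tsum_le_tsum hk)
    rw [ENNReal.tsum_add, ENNReal.tsum_mul_left, ENNReal.tsum_mul_left]
    exact ENNReal.add_ne_top.2 ⟨ENNReal.mul_ne_top ENNReal.ofReal_ne_top hbad,
      ENNReal.mul_ne_top (ENNReal.mul_ne_top ENNReal.ofNat_ne_top (eexp_ne_top _))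
        tsum_eexp_neg_ne_top⟩
  have hB : 2 * S + ENNReal.ofReal (2 * (1 / r ^ 2)) * (2 * R) < ∞ := by
    refine lt_top_iff_ne_top.2 (ENNReal.add_ne_top.2
      ⟨ENNReal.mul_ne_top ENNReal.ofNat_ne_top hS', ENNReal.mul_ne_top ENNReal.ofReal_ne_top
        (ENNReal.mul_ne_top ENNReal.ofNat_ne_top hR)⟩)
  refine (iSup_le fun t => ?_).trans_lt hB
  set L := envelope X G K with hL
  have mL : Measurable (L t) := (measurable_envelope hmono hX hG K t).mono (hF t) le_rfl
  -- With `y` the excess, `X ^ 2 ≤ 2 L ^ 2 + 2 y ^ 2`, and `(r y) ^ 2 ≤ 2 e^(r y)`.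
  calc ∫⁻ ω, ENNReal.ofReal (X t ω ^ 2) ∂P
      ≤ ∫⁻ ω, (2 * ENNReal.ofReal (L t ω ^ 2) + ENNReal.ofReal (2 * (1 / r ^ 2)) *
          (2 * eexp (r * max (|X t ω| - L t ω) 0))) ∂P := by
        refine lintegral_mono fun ω => ?_
        set y := max (|X t ω| - L t ω) 0 with hy
        have hy0 : 0 ≤ y := le_max_right _ _
        have hxy : |X t ω| ≤ L t ω + y := by linarith [le_max_left (|X t ω| - L t ω) 0]
        have h1 : X t ω ^ 2 ≤ 2 * L t ω ^ 2 + 2 * (1 / r ^ 2) * (r * y) ^ 2 := by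
          have : 2 * (1 / r ^ 2) * (r * y) ^ 2 = 2 * y ^ 2 := by field_simp
          rw [this, ← sq_abs]
          have h2 : |X t ω| ^ 2 ≤ (L t ω + y) ^ 2 := pow_le_pow_left₀ (abs_nonneg _) hxy 2
          nlinarith [sq_nonneg (L t ω - y)]
        calc ENNReal.ofReal (X t ω ^ 2)
            ≤ ENNReal.ofReal (2 * L t ω ^ 2 + 2 * (1 / r ^ 2) * (r * y) ^ 2) :=
              ENNReal.ofReal_le_ofReal h1
          _ = 2 * ENNReal.ofReal (L t ω ^ 2)
                + ENNReal.ofReal (2 * (1 / r ^ 2)) * ENNReal.ofReal ((r * y) ^ 2) := by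
              rw [ENNReal.ofReal_add (by positivity) (by positivity),
                ENNReal.ofReal_mul (by positivity), ENNReal.ofReal_mul (p := 2 * (1 / r ^ 2))
                (by positivity), ENNReal.ofReal_ofNat]
          _ ≤ _ := add_le_add le_rfl
              (mul_le_mul' le_rfl (ofReal_sq_le_eexp (mul_nonneg hr.le hy0)))
    _ = 2 * ∫⁻ ω, ENNReal.ofReal (L t ω ^ 2) ∂P + ENNReal.ofReal (2 * (1 / r ^ 2)) *
          (2 * ∫⁻ ω, eexp (r * max (|X t ω| - L t ω) 0) ∂P) := by
        rw [lintegral_add_left ((mL.pow_const 2).ennreal_ofReal.const_mul 2),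
          lintegral_const_mul' _ _ ENNReal.ofNat_ne_top,
          lintegral_const_mul' _ _ ENNReal.ofReal_ne_top,
          lintegral_const_mul' _ _ ENNReal.ofNat_ne_top]
    _ ≤ _ := add_le_add (mul_le_mul' le_rfl (lintegral_envelope_sq_le mX mG hK t))
        (mul_le_mul' le_rfl (mul_le_mul' le_rfl (hRb t)))

end Stability

/-! ### Measurability of the least-squares estimate and the gain. -/

section Measurability

theorem pinv_eq_inv {n : Type*} [Fintype n] [DecidableEq n] {A : Matrix n n ℝ}
    (h : IsUnit A.det) : pinv A = A⁻¹ := by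
  refine (pinv_spec A).unique ⟨?_, ?_, ?_, ?_⟩
  · rw [Matrix.mul_nonsing_inv _ h, Matrix.one_mul]
  · rw [Matrix.nonsing_inv_mul _ h, Matrix.one_mul]
  · rw [Matrix.mul_nonsing_inv _ h, Matrix.transpose_one]
  · rw [Matrix.nonsing_inv_mul _ h, Matrix.transpose_one]

/-- The Moore-Penrose inverse of a singular symmetric `2 × 2` matrix. -/
theorem pinv_eq_smul_of_det_eq_zero {A : Matrix (Fin 2) (Fin 2) ℝ} (hA : Aᵀ = A)
    (h : A.det = 0) : pinv A = (A.trace ^ 2)⁻¹ • A := by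
  have h01 : A 1 0 = A 0 1 := congrFun (congrFun hA 0) 1
  -- Cayley–Hamilton with zero determinant.
  have hsq : A * A = A.trace • A := by
    rw [Matrix.det_fin_two, h01] at h
    ext i j
    fin_cases i <;> fin_cases j <;>
      simp [Matrix.mul_apply, Fin.sum_univ_two, Matrix.trace_fin_two, h01] <;> linarith
  have hzero : A.trace = 0 → A = 0 := by
    intro ht
    rw [Matrix.det_fin_two, h01] at h
    rw [Matrix.trace_fin_two] at ht
    have h1 : A 1 1 = -A 0 0 := by linarith
    rw [h1] at h
    have h2 : A 0 0 = 0 := by nlinarith [sq_nonneg (A 0 0), sq_nonneg (A 0 1)]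
    have h3 : A 0 1 = 0 := by nlinarith [sq_nonneg (A 0 0), sq_nonneg (A 0 1)]
    ext i j
    fin_cases i <;> fin_cases j <;> simp [h01, h1, h2, h3]
  refine (pinv_spec A).unique ⟨?_, ?_, ?_, ?_⟩
  · by_cases ht : A.trace = 0
    · simp [hzero ht]
    · rw [Matrix.mul_smul, Matrix.smul_mul, hsq, Matrix.smul_mul, hsq, smul_smul, smul_smul]
      rw [show (A.trace ^ 2)⁻¹ * A.trace * A.trace = 1 by field_simp, one_smul]
  · by_cases ht : A.trace = 0
    · simp [hzero ht]
    · rw [Matrix.smul_mul, Matrix.smul_mul, Matrix.mul_smul, hsq, Matrix.smul_mul, hsq]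
      simp only [smul_smul]
      congr 1
      field_simp
  · rw [Matrix.mul_smul, hsq, Matrix.transpose_smul, Matrix.transpose_smul, hA]
  · rw [Matrix.smul_mul, hsq, Matrix.transpose_smul, Matrix.transpose_smul, hA]

variable {Ω : Type*} [MeasurableSpace Ω]

/-- The pseudoinverse is discontinuous and defined by choice, so measurability comes from explicit
formulas on the singular and invertible pieces. -/
theorem measurable_pinv_apply {A : Ω → Matrix (Fin 2) (Fin 2) ℝ} (hsymm : ∀ ω, (A ω)ᵀ = A ω)
    (hA : ∀ i j, Measurable fun ω => A ω i j) (i j : Fin 2) :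
    Measurable fun ω => pinv (A ω) i j := by
  have hdet : Measurable fun ω => (A ω).det := by
    simp only [Matrix.det_fin_two]
    exact ((hA 0 0).mul (hA 1 1)).sub ((hA 0 1).mul (hA 1 0))
  have hadj : Measurable fun ω => (A ω).adjugate i j := by
    simp only [Matrix.adjugate_fin_two]
    fin_cases i <;> fin_cases j
    · exact hA 1 1
    · exact (hA 0 1).neg
    · exact (hA 1 0).neg
    · exact hA 0 0
  have htr : Measurable fun ω => (A ω).trace := by
    simp only [Matrix.trace_fin_two]
    exact (hA 0 0).add (hA 1 1)
  have heq : (fun ω => pinv (A ω) i j) = fun ω =>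
      if (A ω).det = 0 then ((A ω).trace ^ 2)⁻¹ * A ω i j
      else (A ω).det⁻¹ * (A ω).adjugate i j := by
    funext ω
    split_ifs with h
    · rw [pinv_eq_smul_of_det_eq_zero (hsymm ω) h, Matrix.smul_apply, smul_eq_mul]
    · rw [pinv_eq_inv (isUnit_iff_ne_zero.2 h), Matrix.inv_def, Ring.inverse_eq_inv',
        Matrix.smul_apply, smul_eq_mul]
  rw [heq]
  exact Measurable.ite (hdet (measurableSet_singleton 0)) ((htr.pow_const 2).inv.mul (hA i j))
    (hdet.inv.mul hadj)

theorem measurable_estimate {X U : ℕ → Ω → ℝ} {t : ℕ} (hX : ∀ s ≤ t + 1, Measurable (X s))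
    (hU : ∀ s ≤ t, Measurable (U s)) (i : Fin 2) :
    Measurable fun ω => estimate (fun s => X s ω) (fun s => U s ω) t i := by
  have hZ : ∀ (s : Fin t) (j : Fin 2),
      Measurable fun ω => dataMatrix (fun s => X s ω) (fun s => U s ω) t s j := by
    intro s j
    fin_cases j
    · exact hX _ (by omega)
    · exact hU _ (by omega)
  have hpinv := measurable_pinv_apply
    (A := fun ω => (dataMatrix (fun s => X s ω) (fun s => U s ω) t)ᵀ *
      dataMatrix (fun s => X s ω) (fun s => U s ω) t)
    (fun ω => by simp) (fun i j => by
      simp only [Matrix.mul_apply, Matrix.transpose_apply]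
      exact Finset.measurable_fun_sum _ fun s _ => (hZ s i).mul (hZ s j))
  simp only [estimate, Matrix.mulVec, dotProduct, Matrix.mul_apply (M := pinv _),
    Matrix.transpose_apply]
  exact Finset.measurable_fun_sum _ fun s _ =>
    (Finset.measurable_fun_sum _ fun k _ => (hpinv i k).mul (hZ s k)).mul (hX _ (by omega))

/-- Inputs enter only strictly before `t`, which lets `U t` be built from the gain without
circularity. Division by zero gives 0, as the policy prescribes. -/
theorem measurable_gain (aInit bInit : ℝ) {X U : ℕ → Ω → ℝ} {t : ℕ}
    (hX : ∀ s ≤ t, Measurable (X s)) (hU : ∀ s < t, Measurable (U s)) :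
    Measurable fun ω => gain aInit bInit (fun s => X s ω) (fun s => U s ω) t := by
  unfold gain
  split_ifs with h
  · exact measurable_const
  · have hest := measurable_estimate (t := t - 1) (fun s hs => hX s (by omega))
      (fun s hs => hU s (by omega))
    exact (hest 0).neg.div (hest 1)

theorem measurable_sat (r : ℝ) : Measurable (sat r) :=
  Measurable.ite (measurableSet_le measurable_norm measurable_const) measurable_id
    ((measurable_id.const_mul r).div measurable_norm)

end Measurability

/-! ### Adaptedness of the loop and independence of the current noise. -/

section Past

variable {Ω : Type*}

/-- The `σ`-algebra generated by the disturbances and excitations strictly before time `t`. -/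
@[reducible]
def pastSigma (W V : ℕ → Ω → ℝ) (t : ℕ) : MeasurableSpace Ω :=
  ⨆ i ∈ {i : ℕ ⊕ ℕ | Sum.elim id id i < t},
    MeasurableSpace.comap ((Sum.elim W V : ℕ ⊕ ℕ → Ω → ℝ) i) inferInstance

theorem pastSigma_mono (W V : ℕ → Ω → ℝ) : Monotone (pastSigma W V) := fun _ _ hst =>
  biSup_mono fun _ hi => lt_of_lt_of_le hi hst

theorem measurable_left_pastSigma (W V : ℕ → Ω → ℝ) {s t : ℕ} (h : s < t) :
    Measurable[pastSigma W V t] (W s) :=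
  measurable_iff_comap_le.2 (le_biSup (fun i => MeasurableSpace.comap
    ((Sum.elim W V : ℕ ⊕ ℕ → Ω → ℝ) i) inferInstance)
    (show Sum.inl s ∈ {i : ℕ ⊕ ℕ | Sum.elim id id i < t} from h))

theorem measurable_right_pastSigma (W V : ℕ → Ω → ℝ) {s t : ℕ} (h : s < t) :
    Measurable[pastSigma W V t] (V s) :=
  measurable_iff_comap_le.2 (le_biSup (fun i => MeasurableSpace.comap
    ((Sum.elim W V : ℕ ⊕ ℕ → Ω → ℝ) i) inferInstance)
    (show Sum.inr s ∈ {i : ℕ ⊕ ℕ | Sum.elim id id i < t} from h))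

theorem pastSigma_le [mΩ : MeasurableSpace Ω] {W V : ℕ → Ω → ℝ} (hW : ∀ t, Measurable (W t))
    (hV : ∀ t, Measurable (V t)) (t : ℕ) : pastSigma W V t ≤ mΩ :=
  iSup₂_le fun i _ => by
    cases i with
    | inl s => exact (hW s).comap_le
    | inr s => exact (hV s).comap_le

theorem indep_pastSigma [mΩ : MeasurableSpace Ω] {P : Measure Ω} {W V : ℕ → Ω → ℝ}
    (hW : ∀ t, Measurable (W t)) (hV : ∀ t, Measurable (V t))
    (hindep : iIndepFun (Sum.elim W V : ℕ ⊕ ℕ → Ω → ℝ) P) (b : ℝ) (t : ℕ) :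
    Indep (pastSigma W V t)
      (MeasurableSpace.comap (fun ω => b * V t ω + W t ω) inferInstance) P := by
  set m : ℕ ⊕ ℕ → MeasurableSpace Ω := fun i =>
    MeasurableSpace.comap ((Sum.elim W V : ℕ ⊕ ℕ → Ω → ℝ) i) inferInstance with hm
  set T : Set (ℕ ⊕ ℕ) := {i | Sum.elim id id i = t} with hT
  have hle : ∀ i, m i ≤ mΩ := fun i => by
    cases i with
    | inl s => exact (hW s).comap_le
    | inr s => exact (hV s).comap_le
  -- The past and the present noise use disjoint index sets of one independent family.
  have hdisj : Disjoint {i : ℕ ⊕ ℕ | Sum.elim id id i < t} T :=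
    Set.disjoint_left.2 fun i hi hi' => (ne_of_lt hi) hi'
  have h := indep_iSup_of_disjoint hle (show iIndep m P from hindep) hdisj
  refine indep_of_indep_of_le_right h (measurable_iff_comap_le.1 ?_)
  have hWt : Measurable[⨆ i ∈ T, m i] (W t) :=
    measurable_iff_comap_le.2 (le_biSup m (show Sum.inl t ∈ T from rfl))
  have hVt : Measurable[⨆ i ∈ T, m i] (V t) :=
    measurable_iff_comap_le.2 (le_biSup m (show Sum.inr t ∈ T from rfl))
  let := ⨆ i ∈ T, m i
  exact (hVt.const_mul b).add hWt

theorem measurable_closedLoop {a b x₀ D aInit bInit : ℝ} {W V X U : ℕ → Ω → ℝ}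
    (hloop : ∀ ω, IsClosedLoop a b x₀ D aInit bInit
      (fun t => W t ω) (fun t => V t ω) (fun t => X t ω) (fun t => U t ω)) (t : ℕ) :
    (∀ s ≤ t, Measurable[pastSigma W V t] (X s)) ∧
      ∀ s < t, Measurable[pastSigma W V t] (U s) := by
  induction t with
  | zero =>
    refine ⟨fun s hs => ?_, fun s hs => absurd hs (by omega)⟩
    obtain rfl : s = 0 := by omega
    have : X 0 = fun _ => x₀ := funext fun ω => (hloop ω).init
    rw [this]
    exact measurable_const
  | succ t ih =>
    have hmono := pastSigma_mono W V t.le_succ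
    have hX : ∀ s ≤ t, Measurable[pastSigma W V (t + 1)] (X s) := fun s hs =>
      (ih.1 s hs).mono hmono le_rfl
    have hU : ∀ s < t, Measurable[pastSigma W V (t + 1)] (U s) := fun s hs =>
      (ih.2 s hs).mono hmono le_rfl
    have hWt := measurable_left_pastSigma W V t.lt_succ_self
    have hVt := measurable_right_pastSigma W V t.lt_succ_self
    let := pastSigma W V (t + 1)
    have hUt : Measurable (U t) := by
      have : U t = fun ω => sat D (gain aInit bInit (fun s => X s ω) (fun s => U s ω) t * X t ω)
          + V t ω := funext fun ω => (hloop ω).control t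
      rw [this]
      exact ((measurable_sat D).comp ((measurable_gain aInit bInit hX hU).mul (hX t le_rfl))).add
        hVt
    have hXt : Measurable (X (t + 1)) := by
      have : X (t + 1) = fun ω => a * X t ω + b * U t ω + W t ω :=
        funext fun ω => (hloop ω).step t
      rw [this]
      exact (((hX t le_rfl).const_mul a).add (hUt.const_mul b)).add hWt
    refine ⟨fun s hs => ?_, fun s hs => ?_⟩
    · rcases Nat.le_succ_iff.1 hs with h | rfl
      exacts [hX s h, hXt]
    · rcases Nat.lt_succ_iff_lt_or_eq.1 hs with h | rfl
      exacts [hU s h, hUt]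

end Past

/-! ### Subgaussianity of the disturbance and the excitation. -/

section Noise

variable {Ω : Type*} [MeasurableSpace Ω] {P : Measure Ω}

theorem hasSubgaussianMGF_of_map_eq_gaussianReal {W : Ω → ℝ} (hW : Measurable W) {v : ℝ≥0}
    (h : P.map W = gaussianReal 0 v) : HasSubgaussianMGF W v P where
  integrable_exp_mul r := by
    have := integrable_exp_mul_gaussianReal (μ := 0) (v := v) r
    rw [← h] at this
    exact this.comp_measurable hW
  mgf_le r := by rw [mgf_gaussianReal h]; simp

theorem hasSubgaussianMGF_of_isUniform [IsProbabilityMeasure P] {V : Ω → ℝ} (hV : Measurable V)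
    {C : ℝ} (hC : 0 < C)
    (h : pdf.IsUniform V (Set.Icc (-C) C) P volume) :
    HasSubgaussianMGF V ((‖C - -C‖₊ / 2) ^ 2) P := by
  -- Hoeffding's lemma for a bounded centred variable.
  refine hasSubgaussianMGF_of_mem_Icc_of_integral_eq_zero hV.aemeasurable ?_ ?_
  · have h1 : ∀ᵐ x ∂(P.map V), x ∈ Set.Icc (-C) C := by
      rw [h]
      exact ae_cond_mem measurableSet_Icc
    exact ae_of_ae_map hV.aemeasurable h1
  · rw [h.integral_eq, integral_Icc_eq_integral_Ioc,
      ← intervalIntegral.integral_of_le (by linarith), integral_id]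
    simp

end Noise

/-! ### Deterministic drift estimates. -/

section Drift

theorem abs_sat_le {r : ℝ} (hr : 0 ≤ r) (x : ℝ) : |sat r x| ≤ r := by
  unfold sat
  split_ifs with h
  · exact h
  · have hx : 0 < |x| := hr.trans_lt (not_le.1 h)
    rw [abs_div, abs_mul, abs_abs, abs_of_nonneg hr, mul_div_cancel_right₀ _ hx.ne']

theorem abs_add_le_max_of_mul_nonpos {p q : ℝ} (h : p * q ≤ 0) : |p + q| ≤ max (|p| - |q|) |q| := by
  rcases abs_cases p with ⟨hp, hp'⟩ | ⟨hp, hp'⟩ <;> rcases abs_cases q with ⟨hq, hq'⟩ | ⟨hq, hq'⟩ <;>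
    rw [hp, hq, le_max_iff, abs_le, abs_le]
  · rcases hp'.eq_or_lt with h0 | h0
    · right; constructor <;> linarith
    · have : q ≤ 0 := nonpos_of_mul_nonpos_right h h0
      left; constructor <;> linarith
  · rcases le_total (p + q) 0 with h0 | h0
    · right; constructor <;> linarith
    · left; constructor <;> linarith
  · rcases le_total (p + q) 0 with h0 | h0
    · left; constructor <;> linarith
    · right; constructor <;> linarith
  · nlinarith

/-- Whatever the control does, `(1 - |a|) * |x|` is at least `2 * |b| * D` beyond the threshold: one
half pays for the control, the other is the drift. -/
theorem abs_add_le_max_of_abs_lt_one {a b D x s : ℝ} (ha : |a| < 1) (hs : |s| ≤ D) :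
    |a * x + b * s| ≤ max (|x| - |b| * D) (2 * (|b| * D) / (1 - |a|) + |b| * D) := by
  have h1 : |a * x + b * s| ≤ |a| * |x| + |b| * D := by
    refine (abs_add_le _ _).trans ?_
    rw [abs_mul, abs_mul]
    exact add_le_add le_rfl (mul_le_mul_of_nonneg_left hs (abs_nonneg _))
  have ha' : 0 < 1 - |a| := by linarith
  refine h1.trans ?_
  rw [le_max_iff]
  rcases le_total |x| (2 * (|b| * D) / (1 - |a|)) with h | h
  · right
    have : |a| * |x| ≤ |x| := mul_le_of_le_one_left (abs_nonneg _) ha.le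
    linarith
  · left
    rw [div_le_iff₀ ha'] at h
    linarith

/-- Saturated, the control opposes `a * x` with force `|b| * D`. Unsaturated, `|b * g| ≥ 1 / 2`
bounds the remainder `|x| / 2` by `|b| * |g * x|`. -/
theorem abs_add_sat_le_max {a b D g x : ℝ} (ha : |a| = 1) (hD : 0 < D) (hg : |b * g + a| ≤ 1 / 2) :
    |a * x + b * sat D (g * x)| ≤ max (|x| - |b| * D) (|b| * D) := by
  have ha2 : a * a = 1 := by rw [← abs_mul_abs_self, ha, one_mul]
  unfold sat
  split_ifs with h
  · refine le_max_of_le_right ?_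
    have h1 : a * x + b * (g * x) = (b * g + a) * x := by ring
    have h2 : 1 / 2 ≤ |b * g| := by
      have := abs_sub_abs_le_abs_sub a (-(b * g))
      rw [abs_neg, sub_neg_eq_add, add_comm a, ha] at this
      linarith
    calc |a * x + b * (g * x)| ≤ 1 / 2 * |x| := by
          rw [h1, abs_mul]; exact mul_le_mul_of_nonneg_right hg (abs_nonneg _)
      _ ≤ |b * g| * |x| := mul_le_mul_of_nonneg_right h2 (abs_nonneg _)
      _ = |b| * |g * x| := by rw [abs_mul, abs_mul, mul_assoc]
      _ ≤ |b| * D := mul_le_mul_of_nonneg_left h (abs_nonneg _)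
  · have hy : 0 < |g * x| := hD.trans (not_le.1 h)
    have hw : |b * (D * (g * x) / |g * x|)| = |b| * D := by
      rw [abs_mul, abs_div, abs_mul D, abs_abs, abs_of_pos hD, mul_div_cancel_right₀ _ hy.ne']
    have hax : |a * x| = |x| := by rw [abs_mul, ha, one_mul]
    have hneg : b * g * a ≤ 0 := by
      have h1 : (b * g + a) * a ≤ 1 / 2 := by
        refine (le_abs_self _).trans ?_
        rwa [abs_mul, ha, mul_one]
      linarith
    have := abs_add_le_max_of_mul_nonpos (p := a * x) (q := b * (D * (g * x) / |g * x|)) (by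
      have : a * x * (b * (D * (g * x) / |g * x|)) = b * g * a * (D / |g * x| * x ^ 2) := by ring
      rw [this]
      exact mul_nonpos_of_nonpos_of_nonneg hneg (by positivity))
    rwa [hw, hax] at this

theorem abs_mul_ratio_add_le {a b a' b' d : ℝ} (ha : |a| = 1) (hb : b ≠ 0)
    (hd : d ≤ |b| / (2 * (2 + |b|))) (h1 : |a' - a| ≤ d) (h2 : |b' - b| ≤ d) :
    |b * (-a' / b') + a| ≤ 1 / 2 := by
  have hb0 : 0 < |b| := abs_pos.2 hb
  rw [le_div_iff₀ (by positivity)] at hd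
  have hd0 : 0 ≤ d := (abs_nonneg _).trans h1
  have h3 : |b| - d ≤ |b'| := by
    have := abs_sub_abs_le_abs_sub b b'
    rw [abs_sub_comm] at this
    linarith
  have hb' : 0 < |b'| := by nlinarith
  have hb'0 : b' ≠ 0 := abs_pos.1 hb'
  -- The numerator is at most `(1 + |b|) * d` and `|b'| ≥ |b| - d`; the bound on `d` makes the ratio
  -- at most `1 / 2`.
  have heq : b * (-a' / b') + a = (a * (b' - b) - b * (a' - a)) / b' := by field_simp; ring
  rw [heq, abs_div, div_le_iff₀ hb']
  calc |a * (b' - b) - b * (a' - a)| ≤ |a * (b' - b)| + |b * (a' - a)| := abs_sub _ _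
    _ ≤ d + |b| * d := by
        rw [abs_mul, abs_mul, ha, one_mul]
        exact add_le_add h2 (mul_le_mul_of_nonneg_left h1 hb0.le)
    _ ≤ 1 / 2 * |b'| := by nlinarith

end Drift

/-! ### Conversion of the tail hypothesis and conclusion. -/

/-- Only the term `i = k - 1` of each inner tail is needed, at `k = t + 2`; the weights match since
`(t + 3) ^ 2 ≤ 4 * (t + 2) ^ 2`. Times 0 and 1, where the gain is the initial one, are bounded
trivially. -/
theorem tsum_sq_mul_ne_top_of_tail {p q : ℕ → ℝ≥0∞} (hp : ∀ t, p t ≤ 1)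
    (hpq : ∀ t, p (t + 2) ≤ q (t + 1))
    (h : (∑' k : {k : ℕ // 1 ≤ k}, (k.1 : ℝ≥0∞) ^ 2 *
        ∑' i : {i : ℕ // 1 ≤ i ∧ k.1 - 1 ≤ i}, q i.1) < ∞) :
    ∑' t : ℕ, ((t : ℝ≥0∞) + 1) ^ 2 * p t ≠ ∞ := by
  rw [← ENNReal.summable.sum_add_tsum_nat_add' (k := 2)]
  refine ENNReal.add_ne_top.2 ⟨?_, ?_⟩
  · refine ENNReal.sum_ne_top.2 fun t _ => ENNReal.mul_ne_top ?_
      (ne_top_of_le_ne_top ENNReal.one_ne_top (hp t))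
    exact ENNReal.pow_ne_top (ENNReal.add_ne_top.2 ⟨ENNReal.natCast_ne_top t, ENNReal.one_ne_top⟩)
  · set f : {k : ℕ // 1 ≤ k} → ℝ≥0∞ := fun k => (k.1 : ℝ≥0∞) ^ 2 *
      ∑' i : {i : ℕ // 1 ≤ i ∧ k.1 - 1 ≤ i}, q i.1 with hf
    have hinj : Function.Injective fun t : ℕ => (⟨t + 2, by omega⟩ : {k : ℕ // 1 ≤ k}) :=
      fun s t hst => by simpa using hst
    refine ne_top_of_le_ne_top (b := 4 * ∑' k, f k)
      (ENNReal.mul_ne_top ENNReal.ofNat_ne_top h.ne) ?_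
    refine le_trans ?_ (mul_le_mul' le_rfl (ENNReal.tsum_comp_le_tsum_of_injective hinj f))
    rw [← ENNReal.tsum_mul_left]
    refine ENNReal.tsum_le_tsum fun t => ?_
    have hq : p (t + 2) ≤ ∑' i : {i : ℕ // 1 ≤ i ∧ t + 2 - 1 ≤ i}, q i.1 :=
      (hpq t).trans (ENNReal.le_tsum (⟨t + 1, by omega⟩ : {i : ℕ // 1 ≤ i ∧ t + 2 - 1 ≤ i}))
    rw [hf]
    dsimp only
    rw [← mul_assoc]
    refine mul_le_mul' ?_ hq
    have : (t + 2 + 1) ^ 2 ≤ 4 * (t + 2) ^ 2 := by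
      rw [show 4 * (t + 2) ^ 2 = (2 * (t + 2)) ^ 2 by ring]
      exact Nat.pow_le_pow_left (by omega) 2
    exact_mod_cast this

theorem lemma3 {Ω : Type*} [MeasurableSpace Ω] (P : Measure Ω) [IsProbabilityMeasure P]
    (a b x₀ Umax C aInit bInit : ℝ) (varW : ℝ≥0)
    (ha : |a| ≤ 1) (hb : b ≠ 0)
    (hC : 0 < C) (hCU : C < Umax) (hbInit : bInit ≠ 0) (hvarW : 0 < varW)
    (W V X U : ℕ → Ω → ℝ)
    (hWmeas : ∀ t, Measurable (W t)) (hVmeas : ∀ t, Measurable (V t))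
    -- all the variables `W 0, W 1, …, V 0, V 1, …` are mutually independent
    (hindep : iIndepFun (Sum.elim W V : ℕ ⊕ ℕ → Ω → ℝ) P)
    (hWlaw : ∀ t, P.map (W t) = gaussianReal 0 varW)
    (hVlaw : ∀ t, pdf.IsUniform (V t) (Set.Icc (-C) C) P volume)
    (hloop : ∀ ω, IsClosedLoop a b x₀ (Umax - C) aInit bInit
      (fun t => W t ω) (fun t => V t ω) (fun t => X t ω) (fun t => U t ω))
    (htail : ∃ m : ℝ, 0 < m ∧ ∀ d : ℝ, 0 < d → d < m →
      (∑' k : {k : ℕ // 1 ≤ k}, (k.1 : ℝ≥0∞) ^ 2 *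
        ∑' i : {i : ℕ // 1 ≤ i ∧ k.1 - 1 ≤ i},
          P {ω | d < ‖estimate (fun t => X t ω) (fun t => U t ω) i.1 - !₂[a, b]‖}) < ∞) :
    ∃ e : ℝ, 0 < e ∧ (⨆ t, ∫⁻ ω, ENNReal.ofReal (X t ω ^ 2) ∂P) < ENNReal.ofReal e := by
  suffices hfin : (⨆ t, ∫⁻ ω, ENNReal.ofReal (X t ω ^ 2) ∂P) < ∞ by
    set B := ⨆ t, ∫⁻ ω, ENNReal.ofReal (X t ω ^ 2) ∂P
    refine ⟨B.toReal + 1, by positivity, ?_⟩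
    rw [ENNReal.lt_ofReal_iff_toReal_lt hfin.ne]
    exact lt_add_one _
  set D := Umax - C with hDdef
  have hD : 0 < D := sub_pos.2 hCU
  have hbD : 0 < |b| * D := mul_pos (abs_pos.2 hb) hD
  set g : ℕ → Ω → ℝ := fun t ω => gain aInit bInit (fun s => X s ω) (fun s => U s ω) t with hg
  set H : ℕ → Ω → ℝ := fun t ω => a * X t ω + b * sat D (g t ω * X t ω) with hHdef
  have hX : ∀ t, Measurable[pastSigma W V t] (X t) := fun t =>
    (measurable_closedLoop hloop t).1 t le_rfl
  have hH : ∀ t, Measurable[pastSigma W V t] (H t) := by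
    intro t
    obtain ⟨h1, h2⟩ := measurable_closedLoop hloop t
    let := pastSigma W V t
    exact ((h1 t le_rfl).const_mul a).add (((measurable_sat D).comp
      ((measurable_gain aInit bInit h1 h2).mul (h1 t le_rfl))).const_mul b)
  have hstep : ∀ t ω, X (t + 1) ω = H t ω + (b * V t ω + W t ω) := by
    intro t ω
    have h1 : X (t + 1) ω = a * X t ω + b * U t ω + W t ω := (hloop ω).step t
    have h2 : U t ω = sat D (g t ω * X t ω) + V t ω := (hloop ω).control t
    rw [h1, h2]
    simp only [hHdef]
    ring
  have hgrow : ∀ t ω, |H t ω| ≤ |X t ω| + |b| * D := by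
    intro t ω
    refine (abs_add_le _ _).trans ?_
    rw [abs_mul, abs_mul]
    exact add_le_add (mul_le_of_le_one_left (abs_nonneg _) ha)
      (mul_le_mul_of_nonneg_left (abs_sat_le hD.le _) (abs_nonneg _))
  have hsub := fun t => ((hasSubgaussianMGF_of_isUniform (hVmeas t) hC
    (hVlaw t)).const_mul b).add_of_indepFun
    (hasSubgaussianMGF_of_map_eq_gaussianReal (hWmeas t) (hWlaw t))
    ((hindep.indepFun (show (Sum.inr t : ℕ ⊕ ℕ) ≠ Sum.inl t by simp)).comp
      (measurable_id.const_mul b) measurable_id)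
  -- The good event is the drift inequality itself, so only the probability of its failure remains
  -- to be controlled.
  have main : ∀ K : ℝ, 0 ≤ K →
      ∑' t : ℕ, ((t : ℝ≥0∞) + 1) ^ 2 * P {ω | |H t ω| ≤ max (|X t ω| - |b| * D) K}ᶜ ≠ ∞ →
      (⨆ t, ∫⁻ ω, ENNReal.ofReal (X t ω ^ 2) ∂P) < ∞ := by
    intro K hK hbad
    refine iSup_lintegral_sq_lt_top (pastSigma_le hWmeas hVmeas) (pastSigma_mono W V) hX hH
      (fun t => ?_) (fun t => ((hVmeas t).const_mul b).add (hWmeas t)) hsub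
      (indep_pastSigma hWmeas hVmeas hindep b) (fun ω => (hloop ω).init) hstep hgrow hbD hK
      (fun t ω hω => hω) hbad
    have h1 := hX t
    have h2 := hH t
    let := pastSigma W V t
    exact measurableSet_le (measurable_norm.comp h2)
      (((measurable_norm.comp h1).sub_const _).max measurable_const)
  rcases ha.lt_or_eq with ha1 | ha1
  · have h1 : 0 < 1 - |a| := by linarith
    refine main (2 * (|b| * D) / (1 - |a|) + |b| * D) (by positivity) ?_
    have : ∀ t, {ω | |H t ω| ≤ max (|X t ω| - |b| * D)
        (2 * (|b| * D) / (1 - |a|) + |b| * D)}ᶜ = ∅ := by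
      intro t
      rw [Set.compl_empty_iff, Set.eq_univ_iff_forall]
      exact fun ω => abs_add_le_max_of_abs_lt_one ha1 (abs_sat_le hD.le _)
    simp only [this, measure_empty, mul_zero, tsum_zero]
    exact ENNReal.zero_ne_top
  · obtain ⟨m, hm, htail⟩ := htail
    have hb0 : 0 < |b| := abs_pos.2 hb
    set d := min (m / 2) (|b| / (2 * (2 + |b|))) with hd
    have hd0 : 0 < d := lt_min (by linarith) (by positivity)
    have hdm : d < m := (min_le_left _ _).trans_lt (by linarith)
    refine main (|b| * D) hbD.le (tsum_sq_mul_ne_top_of_tail (q := fun i =>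
      P {ω | d < ‖estimate (fun t => X t ω) (fun t => U t ω) i - !₂[a, b]‖})
      (fun t => prob_le_one) (fun t => ?_) (htail d hd0 hdm))
    -- The gain at time `t + 2` uses the estimate at `t + 1`; if that is within `d`, the drift
    -- inequality holds at `t + 2`.
    refine measure_mono fun ω hω => ?_
    by_contra hacc
    refine hω ?_
    simp only [Set.mem_ofPred_eq, not_lt] at hacc
    set θ := estimate (fun t => X t ω) (fun t => U t ω) (t + 1)
    have h0 : |θ 0 - a| ≤ d := (PiLp.norm_apply_le (θ - !₂[a, b]) 0).trans hacc
    have h1 : |θ 1 - b| ≤ d := (PiLp.norm_apply_le (θ - !₂[a, b]) 1).trans hacc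
    refine abs_add_sat_le_max ha1 hD ?_
    have hgt : g (t + 2) ω = -(θ 0) / θ 1 := by
      simp only [hg, gain]
      rw [if_neg (by omega)]
      rfl
    rw [hgt]
    exact abs_mul_ratio_add_le (d := d) ha1 hb (min_le_right _ _) h0 h1
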